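/- Let $G$ be the three-dimensional Heisenberg group (real upper unitriangular $3\times 3$ matrices) and let $g_0$ be a left-invariant Riemannian metric on $G$. Then there is a Milnor frame for $g_0$, i.e. a left-invariant frame $F_1,F_2,F_3$ with dual coframe $\omega^1,\omega^2,\omega^3$ such that $[F_2,F_3]=-2F_1$, $[F_3,F_1]=[F_1,F_2]=0$ and $g_0=A_0\,\omega^1\otimes\omega^1+B_0\,\omega^2\otimes\omega^2+C_0\,\omega^3\otimes\omega^3$ with constants $A_0,B_0,C_0>0$; and there is a solution $g(t)$, $0\le t<\infty$, of the Ricci flow $\partial_t g=-2\,\mathrm{Ric}_g$ by left-invariant metrics with $g(0)=g_0$. For every such frame, every such solution and every compact set $K\subset G$, the $L^1$-norm $C_K(g)=\int_K|C_2|_g\,d\mu_g$ of the Cotton–York tensor $C_{ij}=g_{ik}\varepsilon^{klm}\left(\nabla_lR_{mj}-\tfrac14\nabla_lR\,g_{mj}\right)$ (where $|C_2|_g^2=g^{ip}g^{jq}C_{ij}C_{pq}$) satisfies $$C_K(g(t))=4\sqrt6\,A_0^{2/3}B_0^{1/3}C_0^{1/3}\left(12t+\frac{B_0C_0}{A_0}\right)^{-4/3}\mathrm{Vol}(K,h)\qquad(t\ge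 0),$$ where $h=\omega^1\otimes\omega^1+\omega^2\otimes\omega^2+\omega^3\otimes\omega^3$. Consequently $C_K(g(t))\to 0$ as $t\to\infty$, and if $\mathrm{Vol}(K,h)>0$, then $t\mapsto C_K(g(t))$ is strictly decreasing on $[0,\infty)$. -/

import Mathlib

open Set Filter Topology MeasureTheory
open scoped Matrix ContDiff

namespace CottonFlow

/-- Coordinate space `ℝ³` (coordinates are numbered `0, 1, 2`). -/
abbrev E3 : Type := Fin 3 → ℝ

/-! ### The Heisenberg group in its global chart -/

/-- The element of the Heisenberg group with coordinates `p`, as the real upper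
unitriangular matrix `(1 x z; 0 1 y; 0 0 1)`. -/
def unitriangular (p : E3) : Matrix (Fin 3) (Fin 3) ℝ :=
  !![1, p 0, p 2; 0, 1, p 1; 0, 0, 1]

/-- The Heisenberg group law in the coordinates `(x, y, z)` of `unitriangular`. -/
def heisMul (p q : E3) : E3 := ![p 0 + q 0, p 1 + q 1, p 2 + q 2 + p 0 * q 1]

/-- The group law is matrix multiplication. -/
theorem unitriangular_heisMul (p q : E3) :
    unitriangular (heisMul p q) = unitriangular p * unitriangular q := by
  ext i j
  fin_cases i <;> fin_cases j <;>
    simp [unitriangular, heisMul, Matrix.mul_apply, Fin.sum_univ_three] <;> ring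

/-! ### Riemannian geometry on `ℝ³` in coordinates -/

/-- A field of `3 × 3` matrices on `ℝ³`: the components `T i j` of a `(0,2)`-tensor field. -/
abbrev TensorField : Type := E3 → Matrix (Fin 3) (Fin 3) ℝ

/-- A smooth Riemannian metric, by its components `g x i j = g_{ij}(x)`. -/
structure IsRiemannianMetric (g : TensorField) : Prop where
  smooth : ∀ i j, ContDiff ℝ ∞ (fun x => g x i j)
  posDef : ∀ x, (g x).PosDef

/-- The partial derivative `∂_i f`. -/
noncomputable def pd (i : Fin 3) (f : E3 → ℝ) (x : E3) : ℝ :=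
  fderiv ℝ f x (Pi.single i 1)

/-- Christoffel symbols of the Levi-Civita connection:
`Γ^k_{ij} = ½ g^{kl} (∂_i g_{jl} + ∂_j g_{il} - ∂_l g_{ij})`. -/
noncomputable def christoffel (g : TensorField) (k i j : Fin 3) (x : E3) : ℝ :=
  (1 / 2) * ∑ l, (g x)⁻¹ k l *
    (pd i (fun y => g y j l) x + pd j (fun y => g y i l) x - pd l (fun y => g y i j) x)

/-- The Ricci tensor
`R_{ij} = ∂_k Γ^k_{ij} - ∂_j Γ^k_{ik} + Γ^k_{kl} Γ^l_{ij} - Γ^k_{jl} Γ^l_{ik}`. -/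
noncomputable def ricci (g : TensorField) : TensorField := fun x => Matrix.of fun i j =>
  ∑ k, (pd k (christoffel g k i j) x - pd j (christoffel g k i k) x)
    + ∑ k, ∑ l, (christoffel g k k l x * christoffel g l i j x
        - christoffel g k j l x * christoffel g l i k x)

/-- The scalar curvature `R = g^{ij} R_{ij}`. -/
noncomputable def scalarCurv (g : TensorField) (x : E3) : ℝ :=
  ∑ i, ∑ j, (g x)⁻¹ i j * ricci g x i j

/-- The covariant derivative `∇_l T_{mj}` of a `(0,2)`-tensor field. -/
noncomputable def nabla (g T : TensorField) (l m j : Fin 3) (x : E3) : ℝ :=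
  pd l (fun y => T y m j) x
    - ∑ p, christoffel g p l m x * T x p j - ∑ p, christoffel g p l j x * T x m p

/-- The completely antisymmetric symbol `η^{klm}` (index arithmetic is modulo 3). -/
noncomputable def eta (k l m : Fin 3) : ℝ :=
  if l = k + 1 ∧ m = k + 2 then 1 else if l = k + 2 ∧ m = k + 1 then -1 else 0

/-- The tensor `ε^{klm} = η^{klm} / √(det g)`. -/
noncomputable def eps (g : TensorField) (k l m : Fin 3) (x : E3) : ℝ :=
  eta k l m / Real.sqrt (g x).det

/-- The Cotton–York tensor `C_{ij} = g_{ik} ε^{klm} (∇_l R_{mj} - ¼ ∇_l R g_{mj})`. -/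
noncomputable def cottonYork (g : TensorField) : TensorField := fun x => Matrix.of fun i j =>
  ∑ k, ∑ l, ∑ m, g x i k * eps g k l m x *
    (nabla g (ricci g) l m j x - (1 / 4) * pd l (scalarCurv g) x * g x m j)

/-- The pointwise norm `|T|_g = (g^{ip} g^{jq} T_{ij} T_{pq})^{1/2}`. -/
noncomputable def tensorNorm (g T : TensorField) (x : E3) : ℝ :=
  Real.sqrt (∑ i, ∑ j, ∑ p, ∑ q, (g x)⁻¹ i p * (g x)⁻¹ j q * T x i j * T x p q)

/-- The Riemannian measure `dμ_g = √(det g) dx`. -/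
noncomputable def riemVol (g : TensorField) : Measure E3 :=
  volume.withDensity fun x => ENNReal.ofReal (Real.sqrt (g x).det)

/-- `C_K(g) = ∫_K |C₂|_g dμ_g`, the `L¹`-norm of the Cotton–York tensor on `K`. -/
noncomputable def cottonL1 (K : Set E3) (g : TensorField) : ℝ :=
  ∫ x in K, tensorNorm g (cottonYork g) x ∂(riemVol g)

/-- `g t`, `0 ≤ t < ∞`, is a solution of the Ricci flow `∂g/∂t = -2 Ric_g`
(with a one-sided derivative at `t = 0`; values at `t < 0` play no role). -/
structure IsRicciFlow (g : ℝ → TensorField) : Prop where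
  metric : ∀ t, 0 ≤ t → IsRiemannianMetric (g t)
  flow : ∀ t, 0 ≤ t → ∀ x i j,
    HasDerivWithinAt (fun s => g s x i j) (-2 * ricci (g t) x i j) (Ici 0) t

/-! ### Left-invariant objects on the Heisenberg group -/

/-- Every left translation `L_p` is an isometry of `g`: `(L_p)^* g = g`. -/
def IsLeftInvariantMetric (g : TensorField) : Prop :=
  ∀ p q u v : E3,
    (fderiv ℝ (heisMul p) q u) ⬝ᵥ (g (heisMul p q) *ᵥ (fderiv ℝ (heisMul p) q v))
      = u ⬝ᵥ (g q *ᵥ v)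

/-- `dL_p (V) = V` for every left translation `L_p`. -/
def IsLeftInvariantField (V : E3 → E3) : Prop :=
  ∀ p q : E3, fderiv ℝ (heisMul p) q (V q) = V (heisMul p q)

/-- The dual coframe of a frame `F`: row `i` of `coframe F x` is the covector `ω^i` at `x`. -/
noncomputable def coframe (F : Fin 3 → E3 → E3) (x : E3) : Matrix (Fin 3) (Fin 3) ℝ :=
  (Matrix.of fun a i => F i x a)⁻¹

/-- The metric `d₀ ω¹ ⊗ ω¹ + d₁ ω² ⊗ ω² + d₂ ω³ ⊗ ω³` for the dual coframe of `F`. -/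
noncomputable def diagMetric (F : Fin 3 → E3 → E3) (d : Fin 3 → ℝ) : TensorField :=
  fun x => Matrix.of fun a b => ∑ i, d i * coframe F x i a * coframe F x i b

/-- `(F 0, F 1, F 2)` is a Milnor frame `(F₁, F₂, F₃)` for the metric `g₀` on the Heisenberg
group: a left-invariant frame with `[F₂, F₃] = -2 F₁`, `[F₃, F₁] = [F₁, F₂] = 0` and
`g₀ = A₀ ω¹ ⊗ ω¹ + B₀ ω² ⊗ ω² + C₀ ω³ ⊗ ω³`, where `A₀, B₀, C₀ > 0`. -/
structure IsMilnorFrame (g₀ : TensorField) (F : Fin 3 → E3 → E3) (A₀ B₀ C₀ : ℝ) : Prop where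
  leftInvariant : ∀ i, IsLeftInvariantField (F i)
  frame : ∀ x, LinearIndependent ℝ fun i => F i x
  bracket₂₃ : ∀ x, VectorField.lieBracket ℝ (F 1) (F 2) x = (-2 : ℝ) • F 0 x
  bracket₃₁ : ∀ x, VectorField.lieBracket ℝ (F 2) (F 0) x = 0
  bracket₁₂ : ∀ x, VectorField.lieBracket ℝ (F 0) (F 1) x = 0
  posA : 0 < A₀
  posB : 0 < B₀
  posC : 0 < C₀
  diagonal : g₀ = diagMetric F ![A₀, B₀, C₀]

end CottonFlow

open CottonFlow

/-!
A left-invariant tensor field is determined by its value `G` at the identity, and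
`G ↦ shear (-s)ᵀ * G * shear (-s)` transports it to the points with first coordinate `s`. For a
left-invariant metric `g` put `a = g (∂₂, ∂₂)`, the squared length of the central direction, and
`θ = g (∂₂, ·)`. Then `Ric = a / (2 det g) (2 θ ⊗ θ - a g)`, so both the scalar curvature and the
`L¹`-density of the Cotton–York tensor are functions of `a` and `det g` alone; the latter is
`√6 / 2 · a³ / det g`.

Along the Ricci flow `a' = -a³ / det g` and `(det g)' = a²`. Hence `a det g` and
`det g / a² - 3 t` are conserved, and they determine `a³ / det g`, without the metric having to be
diagonal in a Milnor frame for `t > 0`. A Milnor frame of `g₀` only enters through the initial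
values `a = A₀ z²` and `det g₀ = A₀ B₀ C₀ (z² / 2)²`, where `z = ω¹ (∂₂)`.
-/

namespace CottonFlow

local notation "δ" => (1 : Matrix (Fin 3) (Fin 3) ℝ)

/-- The matrix of the differential of left translation by a point whose first coordinate is `s`;
it does not depend on the base point. -/
def shear (s : ℝ) : Matrix (Fin 3) (Fin 3) ℝ :=
  !![1, 0, 0; 0, 1, 0; 0, s, 1]

theorem shear_zero : shear 0 = 1 := by
  simp [shear, Matrix.one_fin_three]

theorem shear_mul_shear (s t : ℝ) : shear s * shear t = shear (s + t) := by
  ext i j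
  fin_cases i <;> fin_cases j <;> simp [shear, Matrix.mul_apply, Fin.sum_univ_three]

theorem shear_neg_mul_shear (s : ℝ) : shear (-s) * shear s = 1 := by
  rw [shear_mul_shear, neg_add_cancel, shear_zero]

theorem shear_mul_shear_neg (s : ℝ) : shear s * shear (-s) = 1 := by
  rw [shear_mul_shear, add_neg_cancel, shear_zero]

theorem det_shear (s : ℝ) : (shear s).det = 1 := by
  simp [shear, Matrix.det_fin_three]

theorem shear_inv (s : ℝ) : (shear s)⁻¹ = shear (-s) :=
  Matrix.inv_eq_left_inv (shear_neg_mul_shear s)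

/-- The value, at points with first coordinate `s`, of the left-invariant `(0,2)`-tensor field with
value `T` at the identity. -/
def shearPull (T : Matrix (Fin 3) (Fin 3) ℝ) (s : ℝ) : Matrix (Fin 3) (Fin 3) ℝ :=
  (shear (-s))ᵀ * T * shear (-s)

/-- The left-invariant `(0,2)`-tensor field with value `T` at the identity. -/
def leftTensor (T : Matrix (Fin 3) (Fin 3) ℝ) : TensorField := fun x =>
  shearPull T (x 0)

theorem shearPull_apply (T : Matrix (Fin 3) (Fin 3) ℝ) (s : ℝ) (i j : Fin 3) :
    shearPull T s i j =
      T i j - s * (δ i 1 * T 2 j + T i 2 * δ j 1) + s ^ 2 * (δ i 1 * T 2 2 * δ j 1) := by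
  fin_cases i <;> fin_cases j <;>
    simp [shearPull, shear, Matrix.mul_apply, Fin.sum_univ_three, Matrix.one_apply] <;> ring

theorem hasDerivAt_shearPull (T : Matrix (Fin 3) (Fin 3) ℝ) (s : ℝ) (i j : Fin 3) :
    HasDerivAt (fun s => shearPull T s i j)
      (-(δ i 1 * shearPull T s 2 j + shearPull T s i 2 * δ j 1)) s := by
  simp only [shearPull_apply]
  refine ((((hasDerivAt_id s).mul_const _).const_sub _).add
    (((hasDerivAt_id s).pow 2).mul_const _)).congr_deriv ?_
  simp
  ring

theorem shearPull_inv (T : Matrix (Fin 3) (Fin 3) ℝ) (s : ℝ) :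
    (shearPull T s)⁻¹ = shear s * T⁻¹ * (shear s)ᵀ := by
  rw [shearPull, Matrix.mul_inv_rev, Matrix.mul_inv_rev, ← Matrix.transpose_nonsing_inv, shear_inv,
    neg_neg, Matrix.mul_assoc]

theorem shearPull_inv_apply (T : Matrix (Fin 3) (Fin 3) ℝ) (s : ℝ) (k l : Fin 3) :
    (shearPull T s)⁻¹ k l = T⁻¹ k l + s * (δ k 2 * T⁻¹ 1 l + T⁻¹ k 1 * δ l 2)
        + s ^ 2 * (δ k 2 * T⁻¹ 1 1 * δ l 2) := by
  rw [shearPull_inv]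
  fin_cases k <;> fin_cases l <;>
    simp [shear, Matrix.mul_apply, Matrix.vecMul, dotProduct, Fin.sum_univ_three,
      Matrix.one_apply] <;> ring

theorem hasDerivAt_shearPull_inv (T : Matrix (Fin 3) (Fin 3) ℝ) (s : ℝ) (k l : Fin 3) :
    HasDerivAt (fun s => (shearPull T s)⁻¹ k l)
      (δ k 2 * (shearPull T s)⁻¹ 1 l + (shearPull T s)⁻¹ k 1 * δ l 2) s := by
  simp only [shearPull_inv_apply]
  refine ((((hasDerivAt_id s).mul_const _).const_add _).add
    (((hasDerivAt_id s).pow 2).mul_const _)).congr_deriv ?_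
  simp
  ring

theorem pd_comp_apply_zero {φ : ℝ → ℝ} {φ' : ℝ} {x : E3} (h : HasDerivAt φ φ' (x 0)) (l : Fin 3) :
    pd l (fun y => φ (y 0)) x = δ l 0 * φ' := by
  have hproj : HasFDerivAt (fun y : E3 => y 0)
      (ContinuousLinearMap.proj (R := ℝ) (φ := fun _ : Fin 3 => ℝ) 0) x :=
    (ContinuousLinearMap.proj (R := ℝ) (φ := fun _ : Fin 3 => ℝ) 0).hasFDerivAt
  rw [pd, HasFDerivAt.fderiv (f := fun y : E3 => φ (y 0)) (h.comp_hasFDerivAt x hproj)]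
  simp [Matrix.one_apply, Pi.single_apply, eq_comm, mul_comm]

theorem det_shearPull (T : Matrix (Fin 3) (Fin 3) ℝ) (s : ℝ) : (shearPull T s).det = T.det := by
  simp [shearPull, Matrix.det_mul, det_shear]

theorem isSymm_shearPull {T : Matrix (Fin 3) (Fin 3) ℝ} (hT : T.IsSymm) (s : ℝ) :
    (shearPull T s).IsSymm := by
  simp [Matrix.IsSymm, shearPull, Matrix.transpose_mul, hT.eq, Matrix.mul_assoc]

theorem det_leftTensor (T : Matrix (Fin 3) (Fin 3) ℝ) (x : E3) : (leftTensor T x).det = T.det :=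
  det_shearPull T (x 0)

theorem leftTensor_apply_two_two (T : Matrix (Fin 3) (Fin 3) ℝ) (x : E3) :
    leftTensor T x 2 2 = T 2 2 := by
  simp [leftTensor, shearPull_apply]

/-! ### Curvature of a left-invariant metric -/

/-- The Christoffel symbols of a left-invariant metric, from the value `g` of the metric at the
same point. -/
noncomputable def heisChristoffel (g : Matrix (Fin 3) (Fin 3) ℝ) (k i j : Fin 3) : ℝ :=
  (1 / 2) * (g⁻¹ k 0 * (δ i 1 * g j 2 + g i 2 * δ j 1)
    - δ i 0 * (δ j 1 * δ k 2 + g j 2 * g⁻¹ k 1) - δ j 0 * (δ i 1 * δ k 2 + g i 2 * g⁻¹ k 1))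

theorem christoffel_leftTensor {G : Matrix (Fin 3) (Fin 3) ℝ} (hG : G.IsSymm) (hdet : G.det ≠ 0)
    (k i j : Fin 3) :
    christoffel (leftTensor G) k i j = fun x => heisChristoffel (leftTensor G x) k i j := by
  funext x
  have hsymm := (isSymm_shearPull hG (x 0)).apply
  have hinv : ∀ k, ∑ l, (shearPull G (x 0))⁻¹ k l * shearPull G (x 0) l 2 = δ k 2 := fun k => by
    rw [← Matrix.mul_apply, Matrix.nonsing_inv_mul _ (by simpa [det_shearPull] using hdet)]
  simp only [Fin.sum_univ_three] at hinv
  simp only [christoffel, leftTensor, pd_comp_apply_zero (hasDerivAt_shearPull ..),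
    heisChristoffel, Fin.sum_univ_three, ← hinv k, hsymm _ 2]
  fin_cases i <;> fin_cases j <;> simp [Matrix.one_apply] <;> ring

theorem hasDerivAt_heisChristoffel (G : Matrix (Fin 3) (Fin 3) ℝ) (k i j : Fin 3) (s : ℝ) :
    HasDerivAt (fun s => heisChristoffel (shearPull G s) k i j)
      ((1 / 2) * (δ k 2 * (shearPull G s)⁻¹ 1 0 *
          (δ i 1 * shearPull G s j 2 + shearPull G s i 2 * δ j 1)
        - 2 * (shearPull G s)⁻¹ k 0 * shearPull G s 2 2 * δ i 1 * δ j 1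
        - δ i 0 * (shearPull G s j 2 * δ k 2 * (shearPull G s)⁻¹ 1 1
          - shearPull G s 2 2 * δ j 1 * (shearPull G s)⁻¹ k 1)
        - δ j 0 * (shearPull G s i 2 * δ k 2 * (shearPull G s)⁻¹ 1 1
          - shearPull G s 2 2 * δ i 1 * (shearPull G s)⁻¹ k 1))) s := by
  have hg := hasDerivAt_shearPull G s
  have hh := hasDerivAt_shearPull_inv G s k
  refine (((((hh 0).mul (((hg j 2).const_mul _).add ((hg i 2).mul_const _))).sub
    ((((hg j 2).mul (hh 1)).const_add _).const_mul _)).sub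
    ((((hg i 2).mul (hh 1)).const_add _).const_mul _)).const_mul _).congr_deriv ?_
  simp
  ring

theorem inv_fin_three_of_isSymm {g : Matrix (Fin 3) (Fin 3) ℝ} (hg : g.IsSymm) :
    g⁻¹ = g.det⁻¹ •
      !![g 1 1 * g 2 2 - g 1 2 ^ 2, g 0 2 * g 1 2 - g 0 1 * g 2 2, g 0 1 * g 1 2 - g 0 2 * g 1 1;
        g 0 2 * g 1 2 - g 0 1 * g 2 2, g 0 0 * g 2 2 - g 0 2 ^ 2, g 0 1 * g 0 2 - g 0 0 * g 1 2;
        g 0 1 * g 1 2 - g 0 2 * g 1 1, g 0 1 * g 0 2 - g 0 0 * g 1 2,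
          g 0 0 * g 1 1 - g 0 1 ^ 2] := by
  rw [Matrix.inv_def, Matrix.adjugate_fin_three, Ring.inverse_eq_inv', hg.apply 0 1, hg.apply 0 2,
    hg.apply 1 2]
  congr! 4 <;> ring_nf

theorem det_fin_three_of_isSymm {g : Matrix (Fin 3) (Fin 3) ℝ} (hg : g.IsSymm) :
    g.det = (g 0 0 * g 1 1 - g 0 1 ^ 2) * g 2 2 - g 0 0 * g 1 2 ^ 2 + 2 * g 0 1 * g 1 2 * g 0 2
      - g 1 1 * g 0 2 ^ 2 := by
  rw [Matrix.det_fin_three, hg.apply 0 1, hg.apply 0 2, hg.apply 1 2]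
  ring

/-- The Ricci tensor of a left-invariant metric, from the value `g` of the metric at the same
point. The covector `g.col 2` is dual to the central vector field. -/
noncomputable def heisRicci (g : Matrix (Fin 3) (Fin 3) ℝ) : Matrix (Fin 3) (Fin 3) ℝ :=
  (g 2 2 / (2 * g.det)) • ((2 : ℝ) • Matrix.vecMulVec (g.col 2) (g.col 2) - g 2 2 • g)

theorem heisRicci_shearPull (G : Matrix (Fin 3) (Fin 3) ℝ) (s : ℝ) :
    heisRicci (shearPull G s) = shearPull (heisRicci G) s := by
  ext i j
  simp [shearPull_apply, heisRicci, det_shearPull, Matrix.vecMulVec_apply]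
  ring

theorem ricci_leftTensor {G : Matrix (Fin 3) (Fin 3) ℝ} (hG : G.IsSymm) (hdet : G.det ≠ 0) :
    ricci (leftTensor G) = leftTensor (heisRicci G) := by
  funext x
  have hdet' : (shearPull G (x 0)).det ≠ 0 := by rwa [det_shearPull]
  have hsymm := isSymm_shearPull hG (x 0)
  rw [leftTensor, ← heisRicci_shearPull]
  ext i j
  simp only [ricci, christoffel_leftTensor hG hdet, leftTensor,
    pd_comp_apply_zero (hasDerivAt_heisChristoffel ..), Matrix.of_apply, heisRicci,
    Matrix.smul_apply, Matrix.sub_apply, Matrix.vecMulVec_apply, Matrix.col_apply, smul_eq_mul]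
  -- The determinant stays an atom until denominators are cleared.
  have hD := det_fin_three_of_isSymm hsymm
  simp only [heisChristoffel, inv_fin_three_of_isSymm hsymm]
  generalize (shearPull G (x 0)).det = D at hD hdet'
  fin_cases i <;> fin_cases j <;>
    simp [Matrix.one_apply, Fin.sum_univ_three, hsymm.apply 0 1, hsymm.apply 0 2,
      hsymm.apply 1 2] <;>
    field_simp <;> (try subst hD) <;> try ring

theorem inv_mulVec_col {g : Matrix (Fin 3) (Fin 3) ℝ} (hdet : g.det ≠ 0) (j : Fin 3) :
    g⁻¹ *ᵥ g.col j = Pi.single j 1 := by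
  rw [← Matrix.mulVec_single_one, Matrix.mulVec_mulVec, Matrix.nonsing_inv_mul _ hdet.isUnit,
    Matrix.one_mulVec]

theorem inv_mul_heisRicci {g : Matrix (Fin 3) (Fin 3) ℝ} (hdet : g.det ≠ 0) :
    g⁻¹ * heisRicci g = (g 2 2 / (2 * g.det)) •
      ((2 : ℝ) • Matrix.vecMulVec (Pi.single 2 1) (g.col 2) - g 2 2 • 1) := by
  simp only [heisRicci, Matrix.mul_smul, mul_sub, Matrix.mul_vecMulVec, inv_mulVec_col hdet,
    Matrix.nonsing_inv_mul _ hdet.isUnit]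

theorem trace_inv_mul_heisRicci {g : Matrix (Fin 3) (Fin 3) ℝ} (hdet : g.det ≠ 0) :
    (g⁻¹ * heisRicci g).trace = -(g 2 2 ^ 2 / (2 * g.det)) := by
  simp [inv_mul_heisRicci hdet, Matrix.trace_vecMulVec]
  ring

theorem scalarCurv_leftTensor {G : Matrix (Fin 3) (Fin 3) ℝ} (hG : G.IsSymm) (hdet : G.det ≠ 0)
    (x : E3) : scalarCurv (leftTensor G) x = -(G 2 2 ^ 2 / (2 * G.det)) := by
  have hdet' : (shearPull G (x 0)).det ≠ 0 := by rwa [det_shearPull]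
  have hsymm : (heisRicci (shearPull G (x 0))).IsSymm := by
    simp [Matrix.IsSymm, heisRicci, (isSymm_shearPull hG (x 0)).eq]
  calc scalarCurv (leftTensor G) x
      = ((shearPull G (x 0))⁻¹ * heisRicci (shearPull G (x 0))).trace := by
        simp only [scalarCurv, ricci_leftTensor hG hdet, leftTensor, ← heisRicci_shearPull,
          Matrix.trace, Matrix.diag_apply, Matrix.mul_apply, hsymm.apply]
    _ = -(G 2 2 ^ 2 / (2 * G.det)) := by
        simp [trace_inv_mul_heisRicci hdet', det_shearPull, shearPull_apply]

theorem sum_heisChristoffel_mul {g : Matrix (Fin 3) (Fin 3) ℝ} (hg : g.IsSymm) (hdet : g.det ≠ 0)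
    (i j p : Fin 3) :
    ∑ k, heisChristoffel g k i j * g k p =
      (1 / 2) * (δ p 0 * (δ i 1 * g j 2 + g i 2 * δ j 1)
        - δ i 0 * (δ j 1 * g p 2 + g j 2 * δ p 1) - δ j 0 * (δ i 1 * g p 2 + g i 2 * δ p 1)) := by
  have hinv : ∀ l, ∑ k, g⁻¹ k l * g k p = δ p l := fun l => by
    simp [← Matrix.mul_nonsing_inv g hdet.isUnit, Matrix.mul_apply, hg.apply, mul_comm]
  have hcol : ∑ k, δ k 2 * g k p = g p 2 := by simp [Matrix.one_apply, hg.apply]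
  simp only [Fin.sum_univ_three] at hinv hcol ⊢
  simp only [heisChristoffel]
  linear_combination (1 / 2) * ((δ i 1 * g j 2 + g i 2 * δ j 1) * hinv 0
    - (δ i 0 * g j 2 + δ j 0 * g i 2) * hinv 1 - (δ i 0 * δ j 1 + δ j 0 * δ i 1) * hcol)

theorem pd_leftTensor (T : Matrix (Fin 3) (Fin 3) ℝ) (l m j : Fin 3) (x : E3) :
    pd l (fun y => leftTensor T y m j) x =
      δ l 0 * -(δ m 1 * leftTensor T x 2 j + leftTensor T x m 2 * δ j 1) :=
  pd_comp_apply_zero (hasDerivAt_shearPull T (x 0) m j) l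

theorem nabla_ricci_leftTensor {G : Matrix (Fin 3) (Fin 3) ℝ} (hG : G.IsSymm) (hdet : G.det ≠ 0)
    (l m j : Fin 3) (x : E3) :
    nabla (leftTensor G) (ricci (leftTensor G)) l m j x =
      (G 2 2 ^ 2 / (2 * G.det)) *
        ((δ m 0 * δ l 1 - δ l 0 * δ m 1) * leftTensor G x j 2
          + leftTensor G x m 2 * (δ j 0 * δ l 1 - δ l 0 * δ j 1)) := by
  have hsymm := isSymm_shearPull hG (x 0)
  have hΓ := sum_heisChristoffel_mul hsymm (by rwa [det_shearPull])
  have hvm := hΓ l m 2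
  have hvj := hΓ l j 2
  have hgm := hΓ l m j
  have hgj := hΓ l j m
  simp only [nabla, ricci_leftTensor hG hdet, pd_leftTensor, christoffel_leftTensor hG hdet]
  simp only [leftTensor, ← heisRicci_shearPull, Fin.sum_univ_three] at hvm hvj hgm hgj ⊢
  rw [← det_shearPull G (x 0), ← leftTensor_apply_two_two G x, leftTensor]
  generalize shearPull G (x 0) = g at *
  simp only [heisRicci, Matrix.smul_apply, Matrix.sub_apply, Matrix.vecMulVec_apply,
    Matrix.col_apply, smul_eq_mul]
  simp only [Matrix.one_apply_ne (show (2 : Fin 3) ≠ 0 by decide),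
    Matrix.one_apply_ne (show (2 : Fin 3) ≠ 1 by decide)] at hvm hvj
  rw [hsymm.apply 0 m, hsymm.apply 1 m, hsymm.apply j 2]
  rw [hsymm.apply j 2] at hgm
  rw [hsymm.apply m 2] at hgj
  -- The Ricci tensor is a constant combination of `θ ⊗ θ` and the parallel tensor `g`.
  linear_combination (-(g 2 2 / (2 * g.det))) *
    (2 * (g j 2 * hvm + g m 2 * hvj) - g 2 2 * (hgm + hgj))

theorem sum_eta_mul_nabla_ricci {G : Matrix (Fin 3) (Fin 3) ℝ} (hG : G.IsSymm) (hdet : G.det ≠ 0)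
    (k j : Fin 3) (x : E3) :
    ∑ l, ∑ m, eta k l m * nabla (leftTensor G) (ricci (leftTensor G)) l m j x =
      (G 2 2 ^ 2 / (2 * G.det)) * (G 2 2 * δ k j - 3 * δ k 2 * leftTensor G x j 2) := by
  have h22 := leftTensor_apply_two_two G x
  simp only [nabla_ricci_leftTensor hG hdet, Fin.sum_univ_three]
  fin_cases k <;> fin_cases j <;> simp [eta, Matrix.one_apply, h22] <;> ring

theorem cottonYork_leftTensor {G : Matrix (Fin 3) (Fin 3) ℝ} (hG : G.IsSymm) (hdet : G.det ≠ 0)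
    (x : E3) :
    cottonYork (leftTensor G) x = (G 2 2 ^ 2 / (2 * G.det * √G.det)) •
      (G 2 2 • leftTensor G x -
        (3 : ℝ) • Matrix.vecMulVec ((leftTensor G x).col 2) ((leftTensor G x).col 2)) := by
  have hconst : ∀ l, pd l (scalarCurv (leftTensor G)) x = 0 := fun l => by
    rw [funext (scalarCurv_leftTensor hG hdet), pd, fderiv_fun_const]
    simp
  ext i j
  calc cottonYork (leftTensor G) x i j
      = ∑ k, leftTensor G x i k / √G.det *
          ∑ l, ∑ m, eta k l m * nabla (leftTensor G) (ricci (leftTensor G)) l m j x := by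
        simp only [cottonYork, Matrix.of_apply, eps, det_leftTensor, hconst, Finset.mul_sum]
        refine Finset.sum_congr rfl fun k _ => Finset.sum_congr rfl fun l _ =>
          Finset.sum_congr rfl fun m _ => ?_
        ring
    _ = _ := by
        simp only [sum_eta_mul_nabla_ricci hG hdet]
        simp [mul_sub, Matrix.one_apply, Matrix.vecMulVec_apply, ← mul_assoc]
        ring

theorem tensorNorm_eq_sqrt_trace (g T : TensorField) (x : E3) :
    tensorNorm g T x = √((g x)⁻¹ * T x * (g x)⁻¹ᵀ * (T x)ᵀ).trace := by
  simp only [tensorNorm, Matrix.trace, Matrix.diag_apply, Matrix.mul_apply, Fin.sum_univ_three,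
    Matrix.transpose_apply]
  ring_nf

theorem tensorNorm_cottonYork_leftTensor {G : Matrix (Fin 3) (Fin 3) ℝ} (hG : G.IsSymm)
    (hdet : 0 < G.det) (hcentral : 0 < G 2 2) (x : E3) :
    tensorNorm (leftTensor G) (cottonYork (leftTensor G)) x =
      √6 * (G 2 2 ^ 3 / (2 * G.det * √G.det)) := by
  have h22 := leftTensor_apply_two_two G x
  have hdetx : (leftTensor G x).det ≠ 0 := (det_leftTensor G x).trans_ne hdet.ne'
  have hsymm : (leftTensor G x).IsSymm := isSymm_shearPull hG (x 0)
  have hC := cottonYork_leftTensor hG hdet.ne' x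
  rw [tensorNorm_eq_sqrt_trace]
  generalize cottonYork (leftTensor G) x = C at *
  generalize leftTensor G x = g at *
  set κ := G 2 2 ^ 2 / (2 * G.det * √G.det) with hκ
  have hCsymm : Cᵀ = C := by simp [hC, hsymm.eq]
  have hinvC : g⁻¹ * C =
      κ • (G 2 2 • 1 - (3 : ℝ) • Matrix.vecMulVec (Pi.single 2 1) (g.col 2)) := by
    simp only [hC, Matrix.mul_smul, mul_sub, Matrix.mul_vecMulVec, inv_mulVec_col hdetx,
      Matrix.nonsing_inv_mul _ hdetx.isUnit]
  have htrace : (g⁻¹ * C * g⁻¹ᵀ * Cᵀ).trace = (κ * G 2 2) ^ 2 * 6 := by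
    rw [Matrix.transpose_nonsing_inv, hsymm.eq, hCsymm, Matrix.mul_assoc, hinvC]
    simp [sub_mul, mul_sub, Matrix.vecMulVec_mul_vecMulVec, Matrix.trace_vecMulVec, h22]
    ring
  rw [htrace, Real.sqrt_mul (sq_nonneg _), Real.sqrt_sq (by positivity), hκ]
  ring

theorem riemVol_of_det_eq {g : TensorField} {D : ℝ} (h : ∀ x, (g x).det = D) :
    riemVol g = ENNReal.ofReal (√D) • volume := by
  simp only [riemVol, h, withDensity_const]

theorem cottonL1_leftTensor {G : Matrix (Fin 3) (Fin 3) ℝ} (hG : G.IsSymm) (hdet : 0 < G.det)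
    (hcentral : 0 < G 2 2) (K : Set E3) :
    cottonL1 K (leftTensor G) = √6 / 2 * (G 2 2 ^ 3 / G.det) * (volume K).toReal := by
  have hsqrt : √G.det ≠ 0 := (Real.sqrt_pos.2 hdet).ne'
  simp only [cottonL1, tensorNorm_cottonYork_leftTensor hG hdet hcentral,
    riemVol_of_det_eq (det_leftTensor G), setIntegral_const, measureReal_def, Measure.smul_apply,
    smul_eq_mul, ENNReal.toReal_mul, ENNReal.toReal_ofReal (Real.sqrt_nonneg _)]
  field_simp

/-! ### Left-invariant metrics, fields and Milnor frames -/

theorem heisMul_zero (x : E3) : heisMul x 0 = x := by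
  ext i
  fin_cases i <;> simp [heisMul]

theorem fderiv_heisMul (p q u : E3) : fderiv ℝ (heisMul p) q u = shear (p 0) *ᵥ u := by
  have h : HasFDerivAt (heisMul p) (Matrix.toLin' (shear (p 0))).toContinuousLinearMap q := by
    have heq : heisMul p = fun q => p + (Matrix.toLin' (shear (p 0))).toContinuousLinearMap q := by
      ext q i
      fin_cases i <;> simp [heisMul, shear, dotProduct, Fin.sum_univ_three]
      ring
    rw [heq]
    exact (ContinuousLinearMap.hasFDerivAt _).const_add p
  rw [h.fderiv]
  simp

theorem isLeftInvariantMetric_iff {g : TensorField} :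
    IsLeftInvariantMetric g ↔
      ∀ p q, (shear (p 0))ᵀ * g (heisMul p q) * shear (p 0) = g q := by
  refine forall₂_congr fun p q => ?_
  rw [← Matrix.toBilin'.injective.eq_iff, LinearMap.ext_iff₂]
  simp only [fderiv_heisMul, Matrix.toBilin'_apply', Matrix.dotProduct_mulVec,
    Matrix.vecMul_mulVec, ← Matrix.vecMul_vecMul, Matrix.mul_assoc]

theorem isLeftInvariantMetric_leftTensor (T : Matrix (Fin 3) (Fin 3) ℝ) :
    IsLeftInvariantMetric (leftTensor T) := by
  refine isLeftInvariantMetric_iff.2 fun p q => ?_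
  have hshear : shear (-(p 0 + q 0)) * shear (p 0) = shear (-q 0) := by
    rw [shear_mul_shear]
    congr 1
    ring
  calc (shear (p 0))ᵀ * leftTensor T (heisMul p q) * shear (p 0)
      = (shear (-(p 0 + q 0)) * shear (p 0))ᵀ * T * (shear (-(p 0 + q 0)) * shear (p 0)) := by
        simp [leftTensor, shearPull, heisMul, Matrix.mul_assoc]
    _ = leftTensor T q := by rw [hshear, leftTensor, shearPull]

theorem IsLeftInvariantMetric.eq_leftTensor {g : TensorField} (h : IsLeftInvariantMetric g) :
    g = leftTensor (g 0) := by
  funext x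
  calc g x = (shear (x 0) * shear (-x 0))ᵀ * g x * (shear (x 0) * shear (-x 0)) := by
        simp [shear_mul_shear_neg]
    _ = leftTensor (g 0) x := by
        rw [leftTensor, shearPull, ← isLeftInvariantMetric_iff.1 h x 0, heisMul_zero]
        simp [Matrix.mul_assoc]

/-- The left-invariant vector field with value `v` at the identity. -/
def leftField (v : E3) (x : E3) : E3 := shear (x 0) *ᵥ v

theorem isLeftInvariantField_leftField (v : E3) : IsLeftInvariantField (leftField v) := by
  intro p q
  have hpq : heisMul p q 0 = p 0 + q 0 := by simp [heisMul]
  rw [fderiv_heisMul, leftField, leftField, Matrix.mulVec_mulVec, shear_mul_shear, hpq]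

theorem IsLeftInvariantField.eq_leftField {V : E3 → E3} (h : IsLeftInvariantField V) :
    V = leftField (V 0) := by
  funext x
  simpa [fderiv_heisMul, heisMul_zero, leftField] using (h x 0).symm

theorem fderiv_leftField (v x u : E3) : fderiv ℝ (leftField v) x u = ![0, 0, u 0 * v 1] := by
  have h : leftField v = fun x =>
      v + (Matrix.mulVecLin !![0, 0, 0; 0, 0, 0; v 1, 0, 0]).toContinuousLinearMap x := by
    funext x
    ext i
    fin_cases i <;> simp [leftField, shear, dotProduct, Fin.sum_univ_three, mul_comm, add_comm]
  rw [h, ((ContinuousLinearMap.hasFDerivAt _).const_add v).fderiv]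
  ext i
  fin_cases i <;> simp [Matrix.mulVec, dotProduct, Fin.sum_univ_three, mul_comm]

theorem lieBracket_leftField (v w x : E3) :
    VectorField.lieBracket ℝ (leftField v) (leftField w) x = ![0, 0, v 0 * w 1 - w 0 * v 1] := by
  rw [VectorField.lieBracket, fderiv_leftField, fderiv_leftField]
  ext i
  fin_cases i <;> simp [leftField, shear, dotProduct, Fin.sum_univ_three]

theorem isRiemannianMetric_leftTensor {G : Matrix (Fin 3) (Fin 3) ℝ} (hG : G.PosDef) :
    IsRiemannianMetric (leftTensor G) where
  smooth i j := by
    simp only [leftTensor, shearPull_apply]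
    fun_prop
  posDef x := by
    have hinj : Function.Injective (shear (-x 0)).mulVec :=
      Matrix.mulVec_injective_of_det_ne_zero (by simp [det_shear])
    rw [leftTensor, shearPull, ← Matrix.conjTranspose_eq_transpose_of_trivial]
    exact hG.conjTranspose_mul_mul_same hinj

theorem diagMetric_eq_mul (F : Fin 3 → E3 → E3) (d : Fin 3 → ℝ) (x : E3) :
    diagMetric F d x = (coframe F x)ᵀ * Matrix.diagonal d * coframe F x := by
  ext i j
  rw [diagMetric, Matrix.of_apply, Matrix.mul_apply]
  simp only [Matrix.mul_diagonal, Matrix.transpose_apply, mul_comm (d _)]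

theorem coframe_eq_mul_shear {F : Fin 3 → E3 → E3} (hF : ∀ i, IsLeftInvariantField (F i)) (x : E3) :
    coframe F x = coframe F 0 * shear (-x 0) := by
  have hframe : (Matrix.of fun a i => F i x a) = shear (x 0) * Matrix.of fun a i => F i 0 a := by
    ext a i
    rw [Matrix.of_apply, (hF i).eq_leftField]
    simp [leftField, Matrix.mul_apply, Matrix.mulVec, dotProduct]
  rw [coframe, hframe, Matrix.mul_inv_rev, shear_inv, coframe]

theorem diagMetric_eq_leftTensor {F : Fin 3 → E3 → E3} (hF : ∀ i, IsLeftInvariantField (F i))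
    (d : Fin 3 → ℝ) : diagMetric F d = leftTensor (diagMetric F d 0) := by
  funext x
  simp only [leftTensor, shearPull, diagMetric_eq_mul, coframe_eq_mul_shear hF x,
    Matrix.transpose_mul, Matrix.mul_assoc]

theorem isSymm_diagMetric (F : Fin 3 → E3 → E3) (d : Fin 3 → ℝ) (x : E3) :
    (diagMetric F d x).IsSymm := by
  simp [Matrix.IsSymm, diagMetric_eq_mul, Matrix.mul_assoc]

theorem IsMilnorFrame.exists_coframe_central {g : TensorField} {F : Fin 3 → E3 → E3}
    {A₀ B₀ C₀ : ℝ} (h : IsMilnorFrame g F A₀ B₀ C₀) :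
    ∃ z : ℝ, z ≠ 0 ∧ ∀ x, (coframe F x).col 2 = Pi.single 0 z ∧
      (coframe F x).det = -(z ^ 2 / 2) := by
  have hbracket := h.bracket₂₃ 0
  rw [(h.leftInvariant 1).eq_leftField, (h.leftInvariant 2).eq_leftField,
    lieBracket_leftField] at hbracket
  obtain ⟨c, hcentral⟩ : ∃ c, F 0 0 = Pi.single 2 c := by
    refine ⟨F 0 0 2, funext fun i => ?_⟩
    have hi := congrFun hbracket i
    fin_cases i <;> simp_all
  have hc : c ≠ 0 := fun hc => (h.frame 0).ne_zero 0 (by rw [hcentral, hc, Pi.single_zero])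
  have hbracket₂ : F 1 0 0 * F 2 0 1 - F 2 0 0 * F 1 0 1 = -2 * c := by
    simpa [hcentral] using congrFun hbracket 2
  have hdet : (Matrix.of fun a i => F i 0 a).det = -2 * c ^ 2 := by
    simp only [Matrix.det_fin_three, Matrix.of_apply, hcentral, Pi.single_apply]
    simp
    linear_combination c * hbracket₂
  have hcol : (Matrix.of fun a i => F i 0 a) *ᵥ Pi.single 0 c⁻¹ = Pi.single 2 1 := by
    ext a
    simp [hcentral, hc, Pi.single_apply]
  have hunit : IsUnit (Matrix.of fun a i => F i 0 a).det := by simpa [hdet] using hc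
  have hshear (s : ℝ) : shear s *ᵥ Pi.single 2 1 = Pi.single 2 1 := by
    ext a
    fin_cases a <;> simp [shear]
  refine ⟨c⁻¹, inv_ne_zero hc, fun x => ⟨?_, ?_⟩⟩
  · rw [coframe_eq_mul_shear h.leftInvariant, ← Matrix.mulVec_single_one, ← Matrix.mulVec_mulVec,
      hshear, coframe, ← hcol, Matrix.mulVec_mulVec,
      Matrix.nonsing_inv_mul _ hunit, Matrix.one_mulVec]
  · rw [coframe_eq_mul_shear h.leftInvariant, Matrix.det_mul, det_shear, mul_one, coframe,
      Matrix.det_nonsing_inv, hdet, Ring.inverse_eq_inv']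
    field_simp

theorem isMilnorFrame_leftField {G Φ : Matrix (Fin 3) (Fin 3) ℝ} {A₀ B₀ C₀ : ℝ} (hA : 0 < A₀)
    (hB : 0 < B₀) (hC : 0 < C₀) (hdiag : Φᵀ * G * Φ = Matrix.diagonal ![A₀, B₀, C₀])
    (hcentral : (-2 : ℝ) • Φ.col 0 = Pi.single 2 (Φ 0 1 * Φ 1 2 - Φ 0 2 * Φ 1 1)) :
    IsMilnorFrame (leftTensor G) (fun i => leftField (Φ.col i)) A₀ B₀ C₀ := by
  have hinv : ∀ i, IsLeftInvariantField (leftField (Φ.col i)) :=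
    fun i => isLeftInvariantField_leftField _
  have hunit : IsUnit Φ.det := by
    have hdet := congrArg Matrix.det hdiag
    rw [Matrix.det_mul, Matrix.det_diagonal, Fin.prod_univ_three] at hdet
    exact isUnit_iff_ne_zero.2 (right_ne_zero_of_mul (hdet.trans_ne (by positivity)))
  have h00 : Φ 0 0 = 0 := by simpa using congrFun hcentral 0
  have h10 : Φ 1 0 = 0 := by simpa using congrFun hcentral 1
  have h20 : -2 * Φ 2 0 = Φ 0 1 * Φ 1 2 - Φ 0 2 * Φ 1 1 := by simpa using congrFun hcentral 2
  refine ⟨hinv, fun x => ?_, fun x => ?_, fun x => ?_, fun x => ?_, hA, hB, hC, ?_⟩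
  · have hcols : (fun i => leftField (Φ.col i) x) = (shear (x 0) * Φ).col := by
      ext i a
      simp [leftField, Matrix.mul_apply, Matrix.mulVec, dotProduct]
    rw [hcols]
    exact Matrix.linearIndependent_cols_iff_isUnit.2 ((Matrix.isUnit_iff_isUnit_det _).2 (by
      simpa [det_shear] using hunit))
  · rw [lieBracket_leftField]
    ext i
    fin_cases i <;> simp [leftField, shear, dotProduct, Fin.sum_univ_three, h00, h10, h20]
  · rw [lieBracket_leftField]
    simp [h00, h10]
  · rw [lieBracket_leftField]
    simp [h00, h10]
  · rw [diagMetric_eq_leftTensor hinv, diagMetric_eq_mul, ← hdiag]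
    have hcoframe : coframe (fun i => leftField (Φ.col i)) 0 = Φ⁻¹ := by
      have hΦ : (Matrix.of fun a i => leftField (Φ.col i) 0 a) = Φ := by
        ext a i
        simp [leftField, shear_zero]
      rw [coframe, hΦ]
    have hmul : Φ * Φ⁻¹ = 1 := Matrix.mul_nonsing_inv Φ hunit
    have hG : G = (Φ⁻¹)ᵀ * (Φᵀ * G * Φ) * Φ⁻¹ :=
      calc G = (Φ * Φ⁻¹)ᵀ * G * (Φ * Φ⁻¹) := by
            rw [hmul, Matrix.transpose_one, Matrix.one_mul, Matrix.mul_one]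
        _ = _ := by simp only [Matrix.transpose_mul, Matrix.mul_assoc]
    rw [hcoframe, ← hG]

theorem exists_orthogonal_transversals {G : Matrix (Fin 3) (Fin 3) ℝ} (hG : G.PosDef) :
    ∃ u w : E3, u 0 ≠ 0 ∧ u 1 = 0 ∧ w 1 ≠ 0 ∧
      u ⬝ᵥ G.col 2 = 0 ∧ w ⬝ᵥ G.col 2 = 0 ∧ w ⬝ᵥ (G *ᵥ u) = 0 := by
  have hsymm : G.IsSymm := by simpa using hG.isHermitian
  have horth (v : E3) : G⁻¹.col 1 ⬝ᵥ (G *ᵥ v) = v 1 := by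
    rw [Matrix.dotProduct_mulVec, ← Matrix.mulVec_transpose, hsymm.eq, ← Matrix.mulVec_single_one,
      Matrix.mulVec_mulVec, Matrix.mul_nonsing_inv _ hG.det_pos.ne'.isUnit, Matrix.one_mulVec,
      single_one_dotProduct]
  refine ⟨![G 2 2, 0, -G 0 2], G⁻¹.col 1, hG.diag_pos.ne', rfl, hG.inv.diag_pos.ne', ?_, ?_, ?_⟩
  · simp [dotProduct, Fin.sum_univ_three, mul_comm]
  · simpa using horth (Pi.single 2 1)
  · simp [horth]

theorem exists_isMilnorFrame {G : Matrix (Fin 3) (Fin 3) ℝ} (hG : G.PosDef) :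
    ∃ (F : Fin 3 → E3 → E3) (A₀ B₀ C₀ : ℝ), IsMilnorFrame (leftTensor G) F A₀ B₀ C₀ := by
  have hsymm : G.IsSymm := by simpa using hG.isHermitian
  obtain ⟨u, w, hu, hu', hw, hu2, hw2, hwu⟩ := exists_orthogonal_transversals hG
  have hpos {v : E3} (hv : v ≠ 0) : 0 < v ⬝ᵥ (G *ᵥ v) := by simpa using hG.dotProduct_mulVec_pos hv
  have hcomm (v v' : E3) : v ⬝ᵥ (G *ᵥ v') = v' ⬝ᵥ (G *ᵥ v) := by
    rw [Matrix.dotProduct_mulVec, ← Matrix.mulVec_transpose, hsymm.eq, dotProduct_comm]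
  have hcentral (v : E3) : (G *ᵥ v) 2 = v ⬝ᵥ G.col 2 := by
    rw [← Matrix.mulVec_single_one, hcomm, single_one_dotProduct]
  -- `-2 F₁ = [F₂, F₃]` is central with coefficient `u 0 * w 1`.
  obtain ⟨c, hc⟩ : ∃ c, -(2 * c) = u 0 * w 1 := ⟨-(u 0 * w 1 / 2), by ring⟩
  have hc0 : c ≠ 0 := by
    rintro rfl
    exact mul_ne_zero hu hw (by simpa using hc.symm)
  set f : Fin 3 → E3 := ![c • Pi.single 2 1, u, w]
  refine ⟨_, c ^ 2 * G 2 2, u ⬝ᵥ (G *ᵥ u), w ⬝ᵥ (G *ᵥ w), isMilnorFrame_leftField (G := G)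
    (Φ := (Matrix.of f)ᵀ) (mul_pos (by positivity) hG.diag_pos)
    (hpos fun h => hu (congrFun h 0)) (hpos fun h => hw (congrFun h 1)) ?_ ?_⟩
  · ext i j
    have hgram : ((Matrix.of f) * G * (Matrix.of f)ᵀ) i j = f i ⬝ᵥ (G *ᵥ f j) := by
      rw [Matrix.mul_assoc]
      rfl
    rw [Matrix.transpose_transpose, hgram]
    fin_cases i <;> fin_cases j <;>
      simp [f, hcentral, hu2, hw2, hwu, hcomm u w, Matrix.mulVec_smul, sq, mul_assoc]
  · ext i
    fin_cases i <;> simp [f, hu', hc]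

theorem IsMilnorFrame.exists_diagMetric_central {g : TensorField} {F : Fin 3 → E3 → E3}
    {A₀ B₀ C₀ : ℝ} (h : IsMilnorFrame g F A₀ B₀ C₀) :
    ∃ z : ℝ, z ≠ 0 ∧ ∀ d x, (diagMetric F d x).col 2 = (z * d 0) • (coframe F x).row 0 ∧
      diagMetric F d x 2 2 = d 0 * z ^ 2 ∧
      (diagMetric F d x).det = d 0 * d 1 * d 2 * (z ^ 2 / 2) ^ 2 := by
  obtain ⟨z, hz, hcoframe⟩ := h.exists_coframe_central
  refine ⟨z, hz, fun d x => ?_⟩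
  obtain ⟨hcol, hdet⟩ := hcoframe x
  have hentry (i : Fin 3) : coframe F x i 2 = Pi.single (M := fun _ => ℝ) 0 z i := congrFun hcol i
  refine ⟨?_, ?_, ?_⟩
  · ext a
    simp [diagMetric, hentry, Pi.single_apply]
    ring
  · simp [diagMetric, hentry, Pi.single_apply]
    ring
  · rw [diagMetric_eq_mul, Matrix.det_mul, Matrix.det_mul, Matrix.det_transpose,
      Matrix.det_diagonal, Fin.prod_univ_three, hdet]
    ring

theorem IsMilnorFrame.posDef_diagMetric {g : TensorField} {F : Fin 3 → E3 → E3}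
    {A₀ B₀ C₀ : ℝ} (h : IsMilnorFrame g F A₀ B₀ C₀) {d : Fin 3 → ℝ} (hd : ∀ i, 0 < d i) (x : E3) :
    (diagMetric F d x).PosDef := by
  obtain ⟨z, hz, hcoframe⟩ := h.exists_coframe_central
  have hunit : IsUnit (coframe F x) := (Matrix.isUnit_iff_isUnit_det _).2 (by
    simpa [(hcoframe x).2] using hz)
  rw [diagMetric_eq_mul, ← Matrix.conjTranspose_eq_transpose_of_trivial]
  exact (Matrix.PosDef.diagonal hd).conjTranspose_mul_mul_same
    (Matrix.mulVec_injective_of_isUnit hunit)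

/-! ### Ricci flow -/

theorem IsMilnorFrame.ricci_diagMetric {g : TensorField} {F : Fin 3 → E3 → E3}
    {A₀ B₀ C₀ : ℝ} (h : IsMilnorFrame g F A₀ B₀ C₀) {d : Fin 3 → ℝ} (hd : ∀ i, d i ≠ 0) :
    ricci (diagMetric F d) = diagMetric F ((2 * d 0 / (d 1 * d 2)) • ![d 0, -d 1, -d 2]) := by
  obtain ⟨z, hz, hcentral⟩ := h.exists_diagMetric_central
  obtain ⟨hcol, h22, hdet⟩ := hcentral d 0
  have h0 := hd 0
  have h1 := hd 1
  have h2 := hd 2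
  rw [diagMetric_eq_leftTensor h.leftInvariant d,
    ricci_leftTensor (isSymm_diagMetric F d 0) (by rw [hdet]; positivity),
    diagMetric_eq_leftTensor h.leftInvariant (_ • _)]
  congr 1
  ext a b
  rw [heisRicci, hcol, h22, hdet]
  simp [diagMetric, Matrix.vecMulVec_apply, Fin.sum_univ_three]
  field_simp
  ring

theorem IsMilnorFrame.isRicciFlow_diagMetric {g : TensorField} {F : Fin 3 → E3 → E3}
    {A₀ B₀ C₀ : ℝ} (h : IsMilnorFrame g F A₀ B₀ C₀) {d : ℝ → Fin 3 → ℝ}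
    (hpos : ∀ t, 0 ≤ t → ∀ i, 0 < d t i)
    (hderiv : ∀ t, 0 ≤ t → ∀ i, HasDerivWithinAt (fun s => d s i)
      (4 * d t 0 / (d t 1 * d t 2) * ![-d t 0, d t 1, d t 2] i) (Ici 0) t) :
    IsRicciFlow fun t => diagMetric F (d t) where
  metric t ht := by
    rw [diagMetric_eq_leftTensor h.leftInvariant]
    exact isRiemannianMetric_leftTensor (h.posDef_diagMetric (hpos t ht) 0)
  flow t ht x a b := by
    rw [h.ricci_diagMetric fun i => (hpos t ht i).ne']
    simp only [diagMetric, Matrix.of_apply, Fin.sum_univ_three]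
    have hterm (i : Fin 3) := ((hderiv t ht i).mul_const (coframe F x i a)).mul_const
      (coframe F x i b)
    refine (((hterm 0).fun_add (hterm 1)).fun_add (hterm 2)).congr_deriv ?_
    simp
    ring

theorem hasDerivAt_one_add_mul_rpow_third {σ t : ℝ} (h : 0 < 1 + σ * t) :
    HasDerivAt (fun t => (1 + σ * t) ^ (1 / 3 : ℝ))
      (σ / (3 * ((1 + σ * t) ^ (1 / 3 : ℝ)) ^ 2)) t := by
  refine ((((hasDerivAt_id t).const_mul σ).const_add 1).rpow_const
    (p := 1 / 3) (Or.inl h.ne')).congr_deriv ?_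
  have hexp : (1 + σ * t) ^ (1 / 3 - 1 : ℝ) = (((1 + σ * t) ^ (1 / 3 : ℝ)) ^ 2)⁻¹ := by
    rw [← Real.rpow_natCast, ← Real.rpow_mul h.le, ← Real.rpow_neg h.le]
    norm_num
  simp only [id_eq, hexp]
  field_simp

theorem IsMilnorFrame.exists_isRicciFlow {g₀ : TensorField} {F : Fin 3 → E3 → E3} {A₀ B₀ C₀ : ℝ}
    (h : IsMilnorFrame g₀ F A₀ B₀ C₀) :
    ∃ g : ℝ → TensorField,
      IsRicciFlow g ∧ (∀ t, 0 ≤ t → IsLeftInvariantMetric (g t)) ∧ g 0 = g₀ := by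
  obtain ⟨hA, hB, hC⟩ : 0 < A₀ ∧ 0 < B₀ ∧ 0 < C₀ := ⟨h.posA, h.posB, h.posC⟩
  set σ := 12 * A₀ / (B₀ * C₀) with hσ
  set φ : ℝ → ℝ := fun t => (1 + σ * t) ^ (1 / 3 : ℝ)
  have hbase : ∀ t, 0 ≤ t → 0 < 1 + σ * t := fun t ht => by positivity
  have hφ : ∀ t, 0 ≤ t → 0 < φ t := fun t ht => Real.rpow_pos_of_pos (hbase t ht) _
  have hφ' : ∀ t, 0 ≤ t → HasDerivAt φ (4 * A₀ / (B₀ * C₀ * φ t ^ 2)) t := fun t ht => by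
    refine (hasDerivAt_one_add_mul_rpow_third (hbase t ht)).congr_deriv ?_
    change σ / (3 * φ t ^ 2) = _
    rw [← div_div, show σ / 3 = 4 * A₀ / (B₀ * C₀) by rw [hσ]; ring, div_div]
  refine ⟨fun t => diagMetric F ![A₀ / φ t, B₀ * φ t, C₀ * φ t],
    h.isRicciFlow_diagMetric (fun t ht i => ?_) (fun t ht i => ?_), fun t _ => ?_, ?_⟩
  · fin_cases i
    exacts [div_pos hA (hφ t ht), mul_pos hB (hφ t ht), mul_pos hC (hφ t ht)]
  · have hne := (hφ t ht).ne'
    fin_cases i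
    · refine ((hasDerivAt_const t A₀).fun_div (hφ' t ht) hne).hasDerivWithinAt.congr_deriv ?_
      simp
      field_simp
    · refine ((hφ' t ht).const_mul B₀).hasDerivWithinAt.congr_deriv ?_
      simp
      field_simp
    · refine ((hφ' t ht).const_mul C₀).hasDerivWithinAt.congr_deriv ?_
      simp
      field_simp
  · change IsLeftInvariantMetric (diagMetric F _)
    rw [diagMetric_eq_leftTensor h.leftInvariant]
    exact isLeftInvariantMetric_leftTensor _
  · simp [φ, h.diagonal]

theorem hasDerivWithinAt_det {n 𝕜 : Type*} [Fintype n] [DecidableEq n] [NontriviallyNormedField 𝕜]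
    {M : 𝕜 → Matrix n n 𝕜} {M' : Matrix n n 𝕜} {s : Set 𝕜} {t : 𝕜}
    (h : ∀ i j, HasDerivWithinAt (fun t => M t i j) (M' i j) s t) :
    HasDerivWithinAt (fun t => (M t).det) ((M t).adjugate * M').trace s t := by
  simp only [Matrix.det_apply]
  refine (HasDerivWithinAt.fun_sum fun σ _ => (HasDerivWithinAt.fun_finsetProd
    fun i _ => h (σ i) i).const_smul (Equiv.Perm.sign σ)).congr_deriv ?_
  have hcol (i : n) : ((M t).adjugate * M') i i = ((M t).updateCol i (M'.col i)).det := by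
    rw [← Matrix.cramer_apply, Matrix.cramer_eq_adjugate_mulVec]
    rfl
  have hprod (σ : Equiv.Perm n) (i : n) :
      ∏ j, (M t).updateCol i (M'.col i) (σ j) j =
        (∏ j ∈ Finset.univ.erase i, M t (σ j) j) * M' (σ i) i := by
    rw [← Finset.prod_erase_mul _ _ (Finset.mem_univ i), Matrix.updateCol_self]
    congr 1
    exact Finset.prod_congr rfl fun j hj => Matrix.updateCol_ne (Finset.ne_of_mem_erase hj)
  simp only [Matrix.trace, Matrix.diag_apply, hcol, Matrix.det_apply, hprod, Finset.smul_sum,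
    smul_eq_mul]
  exact Finset.sum_comm

theorem eq_initial_of_hasDerivWithinAt_zero {f : ℝ → ℝ}
    (h : ∀ t, 0 ≤ t → HasDerivWithinAt f 0 (Ici 0) t) {t : ℝ} (ht : 0 ≤ t) : f t = f 0 :=
  constant_of_has_deriv_right_zero
    (fun s hs => (h s hs.1).continuousWithinAt.mono Icc_subset_Ici_self)
    (fun s hs => (h s hs.1).mono (Ici_subset_Ici.2 hs.1)) t ⟨ht, le_rfl⟩

theorem pow_three_div_eq_rpow_mul_rpow {a D : ℝ} (ha : 0 < a) (hD : 0 < D) :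
    a ^ 3 / D = (a * D) ^ (1 / 3 : ℝ) * (D / a ^ 2) ^ (-4 / 3 : ℝ) := by
  have hcube : a ^ 3 = a * D / (D / a ^ 2) := by field_simp
  have hroot : a = (a * D) ^ (1 / 3 : ℝ) / (D / a ^ 2) ^ (1 / 3 : ℝ) := by
    rw [← Real.div_rpow (by positivity) (by positivity), ← hcube, ← Real.rpow_natCast,
      ← Real.rpow_mul ha.le]
    norm_num
  calc a ^ 3 / D = a / (D / a ^ 2) := by field_simp
    _ = (a * D) ^ (1 / 3 : ℝ) / (D / a ^ 2) ^ (1 / 3 : ℝ) / (D / a ^ 2) := by rw [← hroot]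
    _ = _ := by
      rw [show (-4 / 3 : ℝ) = -(1 / 3) - 1 by norm_num, Real.rpow_sub_one (by positivity),
        Real.rpow_neg (by positivity)]
      ring

section Evolution

variable {g : ℝ → TensorField} (hg : IsRicciFlow g)
  (hinv : ∀ t, 0 ≤ t → IsLeftInvariantMetric (g t))

include hg hinv

theorem hasDerivWithinAt_ricciFlow {t : ℝ} (ht : 0 ≤ t) (i j : Fin 3) :
    HasDerivWithinAt (fun s => g s 0 i j) (((-2 : ℝ) • heisRicci (g t 0)) i j) (Ici 0) t := by
  have hpos := (hg.metric t ht).posDef 0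
  have hsymm : (g t 0).IsSymm := by simpa using hpos.isHermitian
  refine (hg.flow t ht 0 i j).congr_deriv ?_
  rw [(hinv t ht).eq_leftTensor, ricci_leftTensor hsymm hpos.det_pos.ne']
  simp [leftTensor, shearPull, shear_zero]

theorem hasDerivWithinAt_central {t : ℝ} (ht : 0 ≤ t) :
    HasDerivWithinAt (fun s => g s 0 2 2) (-(g t 0 2 2 ^ 3 / (g t 0).det)) (Ici 0) t := by
  have hdet := ((hg.metric t ht).posDef 0).det_pos.ne'
  refine (hasDerivWithinAt_ricciFlow hg hinv ht 2 2).congr_deriv ?_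
  simp only [heisRicci, Matrix.smul_apply, Matrix.sub_apply, Matrix.vecMulVec_apply,
    Matrix.col_apply, smul_eq_mul]
  field_simp
  ring

theorem hasDerivWithinAt_det_ricciFlow {t : ℝ} (ht : 0 ≤ t) :
    HasDerivWithinAt (fun s => (g s 0).det) (g t 0 2 2 ^ 2) (Ici 0) t := by
  have hdet := ((hg.metric t ht).posDef 0).det_pos.ne'
  have hadj : (g t 0).adjugate = (g t 0).det • (g t 0)⁻¹ := by
    rw [Matrix.inv_def, Ring.inverse_eq_inv', smul_inv_smul₀ hdet]
  refine (hasDerivWithinAt_det (hasDerivWithinAt_ricciFlow hg hinv ht)).congr_deriv ?_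
  rw [hadj, Matrix.smul_mul, Matrix.mul_smul, Matrix.trace_smul, Matrix.trace_smul,
    trace_inv_mul_heisRicci hdet, smul_eq_mul, smul_eq_mul]
  field_simp

theorem central_mul_det_eq {t : ℝ} (ht : 0 ≤ t) :
    g t 0 2 2 * (g t 0).det = g 0 0 2 2 * (g 0 0).det := by
  refine eq_initial_of_hasDerivWithinAt_zero (f := fun t => g t 0 2 2 * (g t 0).det)
    (fun s hs => ?_) ht
  have hdet := ((hg.metric s hs).posDef 0).det_pos.ne'
  refine ((hasDerivWithinAt_central hg hinv hs).fun_mul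
    (hasDerivWithinAt_det_ricciFlow hg hinv hs)).congr_deriv ?_
  field_simp
  ring

theorem det_div_central_sq_eq {t : ℝ} (ht : 0 ≤ t) :
    (g t 0).det / g t 0 2 2 ^ 2 = (g 0 0).det / g 0 0 2 2 ^ 2 + 3 * t := by
  suffices h : (g t 0).det / g t 0 2 2 ^ 2 - 3 * t = (g 0 0).det / g 0 0 2 2 ^ 2 - 3 * 0 by
    linear_combination h
  refine eq_initial_of_hasDerivWithinAt_zero
    (f := fun t => (g t 0).det / g t 0 2 2 ^ 2 - 3 * t) (fun s hs => ?_) ht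
  have hpos := (hg.metric s hs).posDef 0
  have hcentral : g s 0 2 2 ≠ 0 := hpos.diag_pos.ne'
  have hdet := hpos.det_pos.ne'
  refine (((hasDerivWithinAt_det_ricciFlow hg hinv hs).fun_div
    ((hasDerivWithinAt_central hg hinv hs).fun_pow 2) (pow_ne_zero 2 hcentral)).fun_sub
    ((hasDerivWithinAt_id s _).const_mul 3)).congr_deriv ?_
  field_simp
  ring

theorem cottonL1_ricciFlow (K : Set E3) {t : ℝ} (ht : 0 ≤ t) :
    cottonL1 K (g t) = √6 / 2 * ((g 0 0 2 2 * (g 0 0).det) ^ (1 / 3 : ℝ) *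
      ((g 0 0).det / g 0 0 2 2 ^ 2 + 3 * t) ^ (-4 / 3 : ℝ)) * (volume K).toReal := by
  have hpos := (hg.metric t ht).posDef 0
  have hsymm : (g t 0).IsSymm := by simpa using hpos.isHermitian
  rw [← central_mul_det_eq hg hinv ht, ← det_div_central_sq_eq hg hinv ht,
    ← pow_three_div_eq_rpow_mul_rpow hpos.diag_pos hpos.det_pos, (hinv t ht).eq_leftTensor,
    cottonL1_leftTensor hsymm hpos.det_pos hpos.diag_pos]
  simp [leftTensor, shearPull, shear_zero]

end Evolution

theorem conserved_rpow_mul_rpow_eq {A₀ B₀ C₀ z t : ℝ} (hA : 0 < A₀) (hB : 0 < B₀) (hC : 0 < C₀)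
    (hz : z ≠ 0) (ht : 0 ≤ t) :
    (A₀ * z ^ 2 * (A₀ * B₀ * C₀ * (z ^ 2 / 2) ^ 2)) ^ (1 / 3 : ℝ) *
        (A₀ * B₀ * C₀ * (z ^ 2 / 2) ^ 2 / (A₀ * z ^ 2) ^ 2 + 3 * t) ^ (-4 / 3 : ℝ) =
      4 * (A₀ ^ (2 / 3 : ℝ) * B₀ ^ (1 / 3 : ℝ) * C₀ ^ (1 / 3 : ℝ) *
        (12 * t + B₀ * C₀ / A₀) ^ (-4 / 3 : ℝ)) * z ^ 2 := by
  have hA2 : (A₀ ^ 2) ^ (1 / 3 : ℝ) = A₀ ^ (2 / 3 : ℝ) := by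
    rw [← Real.rpow_natCast, ← Real.rpow_mul hA.le]
    norm_num
  have hz3 : ((z ^ 2) ^ 3) ^ (1 / 3 : ℝ) = z ^ 2 := by
    rw [← Real.rpow_natCast, ← Real.rpow_mul (by positivity)]
    norm_num
  have h4 : (4⁻¹ : ℝ) ^ (1 / 3 : ℝ) * 4⁻¹ ^ (-4 / 3 : ℝ) = 4 := by
    rw [← Real.rpow_add (by norm_num), show (1 / 3 + -4 / 3 : ℝ) = -1 by norm_num,
      Real.rpow_neg_one, inv_inv]
  have hprod : A₀ * z ^ 2 * (A₀ * B₀ * C₀ * (z ^ 2 / 2) ^ 2) =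
      A₀ ^ 2 * B₀ * C₀ * 4⁻¹ * (z ^ 2) ^ 3 := by ring
  have hratio : A₀ * B₀ * C₀ * (z ^ 2 / 2) ^ 2 / (A₀ * z ^ 2) ^ 2 + 3 * t =
      4⁻¹ * (12 * t + B₀ * C₀ / A₀) := by
    field_simp
    ring
  rw [hprod, hratio, Real.mul_rpow (by positivity) (by positivity),
    Real.mul_rpow (by positivity) (by norm_num), Real.mul_rpow (by positivity) hC.le,
    Real.mul_rpow (by positivity) hB.le, Real.mul_rpow (by norm_num) (by positivity), hA2, hz3]
  linear_combination A₀ ^ (2 / 3 : ℝ) * B₀ ^ (1 / 3 : ℝ) * C₀ ^ (1 / 3 : ℝ) *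
    (12 * t + B₀ * C₀ / A₀) ^ (-4 / 3 : ℝ) * z ^ 2 * h4

theorem IsMilnorFrame.cottonL1_eq {g : ℝ → TensorField} {F : Fin 3 → E3 → E3}
    {A₀ B₀ C₀ : ℝ} (h : IsMilnorFrame (g 0) F A₀ B₀ C₀) (hg : IsRicciFlow g)
    (hinv : ∀ t, 0 ≤ t → IsLeftInvariantMetric (g t)) (K : Set E3) {t : ℝ} (ht : 0 ≤ t) :
    cottonL1 K (g t) =
      4 * √6 * A₀ ^ (2 / 3 : ℝ) * B₀ ^ (1 / 3 : ℝ) * C₀ ^ (1 / 3 : ℝ)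
        * (12 * t + B₀ * C₀ / A₀) ^ (-4 / 3 : ℝ)
        * (riemVol (diagMetric F ![1, 1, 1]) K).toReal := by
  obtain ⟨z, hz, hcentral⟩ := h.exists_diagMetric_central
  obtain ⟨-, h22, hdet⟩ := hcentral ![A₀, B₀, C₀] 0
  have hvol : (riemVol (diagMetric F ![1, 1, 1]) K).toReal = z ^ 2 / 2 * (volume K).toReal := by
    have hsqrt : √((z ^ 2 / 2) ^ 2) = z ^ 2 / 2 := Real.sqrt_sq (by positivity)
    rw [riemVol_of_det_eq fun x => (hcentral ![1, 1, 1] x).2.2]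
    simp [hsqrt, ENNReal.toReal_ofReal (show 0 ≤ z ^ 2 / 2 by positivity)]
  rw [cottonL1_ricciFlow hg hinv K ht, hvol, h.diagonal, h22, hdet]
  simp only [Matrix.cons_val_zero, Matrix.cons_val_one, Matrix.cons_val]
  rw [conserved_rpow_mul_rpow_eq h.posA h.posB h.posC hz ht]
  ring

theorem strictAntiOn_mul_affine_rpow {k m u p : ℝ} (hk : 0 < k) (hm : 0 < m) (hu : 0 < u)
    (hp : p < 0) : StrictAntiOn (fun t : ℝ => k * (m * t + u) ^ p) (Ici 0) := by
  intro s hs t _ hst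
  have hs' : 0 ≤ s := hs
  exact mul_lt_mul_of_pos_left
    (Real.rpow_lt_rpow_of_neg (by positivity) (by gcongr) hp) hk

theorem tendsto_mul_affine_rpow (k u : ℝ) {m p : ℝ} (hm : 0 < m) (hp : p < 0) :
    Tendsto (fun t : ℝ => k * (m * t + u) ^ p) atTop (𝓝 0) := by
  have haffine : Tendsto (fun t : ℝ => m * t + u) atTop atTop :=
    tendsto_atTop_add_const_right _ _ (tendsto_id.const_mul_atTop hm)
  simpa using ((tendsto_rpow_neg_atTop (neg_pos.2 hp)).comp haffine).const_mul k

theorem IsMilnorFrame.riemVol_lt_top {g : TensorField} {F : Fin 3 → E3 → E3} {A₀ B₀ C₀ : ℝ}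
    (h : IsMilnorFrame g F A₀ B₀ C₀) (d : Fin 3 → ℝ) {K : Set E3} (hK : IsCompact K) :
    riemVol (diagMetric F d) K < ⊤ := by
  obtain ⟨z, -, hcentral⟩ := h.exists_diagMetric_central
  rw [riemVol_of_det_eq fun x => (hcentral d x).2.2, Measure.smul_apply, smul_eq_mul]
  exact ENNReal.mul_lt_top ENNReal.ofReal_lt_top hK.measure_lt_top

end CottonFlow

theorem theorem3p8_general (g₀ : TensorField) (hg₀ : IsRiemannianMetric g₀)
    (hinv : IsLeftInvariantMetric g₀) :
    (∃ (F : Fin 3 → E3 → E3) (A₀ B₀ C₀ : ℝ), IsMilnorFrame g₀ F A₀ B₀ C₀) ∧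
    (∃ g : ℝ → TensorField,
      IsRicciFlow g ∧ (∀ t, 0 ≤ t → IsLeftInvariantMetric (g t)) ∧ g 0 = g₀) ∧
    (∀ (F : Fin 3 → E3 → E3) (A₀ B₀ C₀ : ℝ), IsMilnorFrame g₀ F A₀ B₀ C₀ →
      ∀ g : ℝ → TensorField, IsRicciFlow g → (∀ t, 0 ≤ t → IsLeftInvariantMetric (g t)) →
        g 0 = g₀ →
        ∀ K : Set E3, riemVol (diagMetric F ![1, 1, 1]) K ≠ ⊤ →
          (∀ t, 0 ≤ t →
            cottonL1 K (g t) =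
              4 * √6 * A₀ ^ (2 / 3 : ℝ) * B₀ ^ (1 / 3 : ℝ) * C₀ ^ (1 / 3 : ℝ)
                * (12 * t + B₀ * C₀ / A₀) ^ (-4 / 3 : ℝ)
                * (riemVol (diagMetric F ![1, 1, 1]) K).toReal) ∧
          (0 < riemVol (diagMetric F ![1, 1, 1]) K →
            StrictAntiOn (fun t => cottonL1 K (g t)) (Ici 0)) ∧
          Tendsto (fun t => cottonL1 K (g t)) atTop (𝓝 0)) := by
  obtain ⟨F, A₀, B₀, C₀, hF⟩ : ∃ (F : Fin 3 → E3 → E3) (A₀ B₀ C₀ : ℝ),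
      IsMilnorFrame g₀ F A₀ B₀ C₀ := by
    rw [hinv.eq_leftTensor]
    exact exists_isMilnorFrame (hg₀.posDef 0)
  refine ⟨⟨F, A₀, B₀, C₀, hF⟩, hF.exists_isRicciFlow, ?_⟩
  rintro F A₀ B₀ C₀ hF g hg hginv rfl K hK
  obtain ⟨hA, hB, hC⟩ : 0 < A₀ ∧ 0 < B₀ ∧ 0 < C₀ := ⟨hF.posA, hF.posB, hF.posC⟩
  have hformula (t : ℝ) (ht : 0 ≤ t) := hF.cottonL1_eq hg hginv K ht
  have heqOn : EqOn (fun t => 4 * √6 * A₀ ^ (2 / 3 : ℝ) * B₀ ^ (1 / 3 : ℝ) * C₀ ^ (1 / 3 : ℝ)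
      * (riemVol (diagMetric F ![1, 1, 1]) K).toReal * (12 * t + B₀ * C₀ / A₀) ^ (-4 / 3 : ℝ))
      (fun t => cottonL1 K (g t)) (Ici 0) := fun t ht => by
    simp only [hformula t ht, mul_right_comm]
  refine ⟨hformula, fun hvol => ?_, ?_⟩
  · have hvol' := ENNReal.toReal_pos hvol.ne' hK
    exact (strictAntiOn_mul_affine_rpow (by positivity) (by norm_num) (by positivity)
      (by norm_num)).congr heqOn
  · exact (tendsto_mul_affine_rpow _ _ (by norm_num) (by norm_num)).congr'
      ((eventually_ge_atTop 0).mono heqOn)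

theorem theorem3p8 (g₀ : TensorField) (hg₀ : IsRiemannianMetric g₀)
    (hinv : IsLeftInvariantMetric g₀) :
    -- a Milnor frame for the initial metric exists
    (∃ (F : Fin 3 → E3 → E3) (A₀ B₀ C₀ : ℝ), IsMilnorFrame g₀ F A₀ B₀ C₀) ∧
    -- the left-invariant Ricci flow starting at the initial metric exists for all `t ≥ 0`
    (∃ g : ℝ → TensorField,
      IsRicciFlow g ∧ (∀ t, 0 ≤ t → IsLeftInvariantMetric (g t)) ∧ g 0 = g₀) ∧
    -- the behaviour of the `L¹`-norm of the Cotton–York tensor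
    (∀ (F : Fin 3 → E3 → E3) (A₀ B₀ C₀ : ℝ), IsMilnorFrame g₀ F A₀ B₀ C₀ →
      ∀ g : ℝ → TensorField, IsRicciFlow g → (∀ t, 0 ≤ t → IsLeftInvariantMetric (g t)) →
        g 0 = g₀ →
        ∀ K : Set E3, IsCompact K →
          (∀ t, 0 ≤ t →
            cottonL1 K (g t) =
              4 * Real.sqrt 6 * A₀ ^ (2 / 3 : ℝ) * B₀ ^ (1 / 3 : ℝ) * C₀ ^ (1 / 3 : ℝ)
                * (12 * t + B₀ * C₀ / A₀) ^ (-4 / 3 : ℝ)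
                * (riemVol (diagMetric F ![1, 1, 1]) K).toReal) ∧
          (0 < riemVol (diagMetric F ![1, 1, 1]) K →
            StrictAntiOn (fun t => cottonL1 K (g t)) (Ici 0)) ∧
          Tendsto (fun t => cottonL1 K (g t)) atTop (𝓝 0)) := by
  exact (theorem3p8_general g₀ hg₀ hinv).imp_right <| And.imp_right fun h F A₀ B₀ C₀ hF g hg hginv
    hg0 K hK => h F A₀ B₀ C₀ hF g hg hginv hg0 K (hF.riemVol_lt_top _ hK).ne
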